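/- **Setting.** Fix variable names $V$ and a finite set $N$ of nonterminals. Pure expressions are $e ::= x \mid e\,@\,e \mid \lambda x.e$; extended expressions may in addition contain nonterminals $A\in N$. A $\lambda$-regular grammar $\Gamma$ is a finite set of productions $A ::= e$ with $e$ extended. The derivation relation $e \Rightarrow^*_\Gamma t$ ($e$ extended, $t$ pure) is the smallest relation such that (i) if the nonterminal occurrences of $e$ are $X_1,\dots,X_k$ and $X_i\Rightarrow^*_\Gamma t_i$ for all $i$, then $e\Rightarrow^*_\Gamma e[t_1/X_1,\dots,t_k/X_k]$ (each occurrence is replaced independently, without renaming of bound variables); (ii) if $A::=e\in\Gamma$ and $e\Rightarrow^*_\Gamma t$, then $A\Rightarrow^*_\Gamma t$. Put $\mathrm{fv}(e)=\{x \mid \exists t.\ e\Rightarrow^*_\Gamma t,\ x\in \mathrm{fv}(t)\}$; an extended program is an extended expression $P$ all of whose derived pure expressions are closed. $\mathrm{subexps}(P)$ consists of all subterms of $P$, of all right-hand sides of productions of nonterminals occurring in them, and so on. **Exact semantics (pure).** States are $e:\rho$, where the environment $\rho$ is a map from a finite set of variables containing $\mathrm{fv}(e)$ to values, and values are states of the form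 $\lambda x.e:\rho$. Evaluation $\Downarrow$ and calls ${\to}={\to_r}\cup{\to_d}\cup{\to_c}$ are given by: $\lambda x.e:\rho\Downarrow\lambda x.e:\rho$; $x:\rho\Downarrow\rho(x)$; $e_1@e_2:\rho\to_r e_1:\rho$; if $e_1:\rho\Downarrow v_1$ then $e_1@e_2:\rho\to_d e_2:\rho$; if $e_1:\rho\Downarrow\lambda x.e_0:\rho_0$ and $e_2:\rho\Downarrow v_2$ then $e_1@e_2:\rho\to_c e_0:\rho_0[x\mapsto v_2]$; if $e_1@e_2:\rho\to_c s'$ and $s'\Downarrow v$ then $e_1@e_2:\rho\Downarrow v$. A closed pure $Q$ terminates if $Q:[\,]\Downarrow v$ for some $v$; an infinite call sequence of $Q$ is an infinite chain $Q:[\,]=s_0\to s_1\to\cdots$. An extended program $P$ with nonterminal occurrences $A_1,\dots,A_k$ is $\Gamma$-terminating if $P[t_1/A_1,\dots,t_k/A_k]$ terminates for all pure $t_i$ with $A_i\Rightarrow^*_\Gamma t_i$. **Size-change graphs** are sets of arcs $p\xrightarrow{r}q$ with $r\in\{=,\downarrow\}$, where $p,q$ are variables or the symbol $\epsilon$. In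 $G_1;G_2$ there is an arc $p\xrightarrow{\downarrow}q$ iff some path $p\xrightarrow{r}m\xrightarrow{s}q$ (first arc in $G_1$, second in $G_2$) has $r$ or $s$ equal to $\downarrow$, and an arc $p\xrightarrow{=}q$ iff there is such a path and all labels on all such paths are $=$. Put $\mathrm{id}^{=}_e=\{\epsilon\xrightarrow{=}\epsilon\}\cup\{y\xrightarrow{=}y\mid y\in\mathrm{fv}(e)\}$ and $\mathrm{id}^{\downarrow}_e=\{\epsilon\xrightarrow{\downarrow}\epsilon\}\cup\{y\xrightarrow{=}y\mid y\in\mathrm{fv}(e)\}$. With $y,z$ ranging over variables and $p,q$ over variables and $\epsilon$, $G^{-\epsilon/\lambda x.e_0}$ is $\{y\xrightarrow{r}z\mid y\xrightarrow{r}z\in G\}\cup\{\epsilon\xrightarrow{\downarrow}z\mid\epsilon\xrightarrow{r}z\in G\}$ if $x\in\mathrm{fv}(e_0)$, and $\{y\xrightarrow{r}z\mid y\xrightarrow{r}z\in G\}\cup\{\epsilon\xrightarrow{\downarrow}q\mid\epsilon\xrightarrow{r}q\in G\}\cup\{p\xrightarrow{\downarrow}\epsilon\mid p\xrightarrow{r}\epsilon\in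 G\}$ otherwise; $G^{\epsilon\mapsto x}=\{y\xrightarrow{r}x\mid y\xrightarrow{r}\epsilon\in G\}\cup\{\epsilon\xrightarrow{\downarrow}x\mid\epsilon\xrightarrow{r}\epsilon\in G\}$; and $G\cup_e G'$ consists of the arcs of $G\cup G'$ that end in $\mathrm{fv}(e)\cup\{\epsilon\}$. **Approximate extended semantics of $P$.** The judgements $e\Downarrow v,G$ and $e\to_k e',G$ ($k\in\{r,d,c,n\}$) on extended expressions are defined inductively by: - $\lambda x.e\Downarrow\lambda x.e,\ \mathrm{id}^{=}_{\lambda x.e}$; - if $e_1@e_2\in\mathrm{subexps}(P)$, $e_1\Downarrow\lambda x.e_0,G_1$ and $e_2\Downarrow v_2,G_2$, then $x\Downarrow v_2,\ \{x\xrightarrow{=}\epsilon\}\cup\{x\xrightarrow{\downarrow}y\mid y\in\mathrm{fv}(v_2)\}$; - $A\to_n e,\ \mathrm{id}^{=}_e$ for $A::=e\in\Gamma$; - $e_1@e_2\to_r e_1,\ \mathrm{id}^{\downarrow}_{e_1}$ and $e_1@e_2\to_d e_2,\ \mathrm{id}^{\downarrow}_{e_2}$; - if $e_1\Downarrow\lambda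 x.e_0,G_1$ and $e_2\Downarrow v_2,G_2$, then $e_1@e_2\to_c e_0,\ G_1^{-\epsilon/\lambda x.e_0}\cup_{e_0}G_2^{\epsilon\mapsto x}$; - if $e\to_k e',G'$ with $k\in\{c,n\}$ and $e'\Downarrow v,G$, then $e\Downarrow v,\ G';G$. An infinite call sequence of $P$ in this semantics consists of $P=e_0,e_1,\dots$ and graphs $G_0,G_1,\dots$ such that $e_i\to_k e_{i+1},G_i$ for some $k$, for every $i$. It has an infinitely descending thread if there are $j$ and arcs $a_i\xrightarrow{r_i}a_{i+1}\in G_i$ for all $i\ge j$ with $r_i={\downarrow}$ for infinitely many $i$. **Theorem.** Let $P$ be an extended program over a $\lambda$-regular grammar $\Gamma$. 1. If there is a closed pure expression $Q$ with $P\Rightarrow^*_\Gamma Q$ that has an infinite call sequence in the exact semantics, then $P$ has an infinite call sequence in the approximate extended semantics with no infinitely descending thread. 2. Consequently, if every infinite call sequence of $P$ in the approximate extended semantics has an infinitely descending thread, then $P$ is $\Gamma$-terminating. -/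

import Mathlib

namespace LambdaSCT

universe u v

/-! ## Pure and extended expressions, grammars -/

/-- `Exp`: pure lambda-expressions with variable names from `V`. -/
inductive PureExp (V : Type u) : Type u
  | var (x : V) : PureExp V
  | app (e₁ e₂ : PureExp V) : PureExp V
  | lam (x : V) (e : PureExp V) : PureExp V

/-- Free variables of a pure expression. -/
def PureExp.fv {V : Type u} : PureExp V → Set V
  | .var x => {x}
  | .app e₁ e₂ => e₁.fv ∪ e₂.fv
  | .lam x e => e.fv \ {x}

/-- A pure program is a closed pure expression. -/
def PureExp.Closed {V : Type u} (e : PureExp V) : Prop := e.fv = ∅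

/-- `Exp_Γ`: extended lambda-expressions, which may contain nonterminals from `N`. -/
inductive ExtExp (V : Type u) (N : Type v) : Type (max u v)
  | var (x : V) : ExtExp V N
  | nt (A : N) : ExtExp V N
  | app (e₁ e₂ : ExtExp V N) : ExtExp V N
  | lam (x : V) (e : ExtExp V N) : ExtExp V N

namespace ExtExp

variable {V : Type u} {N : Type v}

/-- The occurrences of nonterminals in `e` (the index set of the multiset `nt(e)`). -/
def Occ : ExtExp V N → Type
  | .var _ => Empty
  | .nt _ => Unit
  | .app e₁ e₂ => e₁.Occ ⊕ e₂.Occ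
  | .lam _ e => e.Occ

/-- The nonterminal standing at an occurrence. -/
def occName : (e : ExtExp V N) → e.Occ → N
  | .nt A, _ => A
  | .app e₁ _, .inl i => e₁.occName i
  | .app _ e₂, .inr i => e₂.occName i
  | .lam _ e, i => e.occName i

/-- `e[t₁/X₁, …, tₖ/Xₖ]`: every nonterminal occurrence is replaced, independently of the
others, by a pure expression (bound variables are not renamed). -/
def subst : (e : ExtExp V N) → (e.Occ → PureExp V) → PureExp V
  | .var x, _ => .var x
  | .nt _, τ => τ ()
  | .app e₁ e₂, τ => .app (e₁.subst fun i => τ (.inl i)) (e₂.subst fun i => τ (.inr i))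
  | .lam x e, τ => .lam x (e.subst τ)

end ExtExp

/-- A lambda-regular grammar with nonterminals `N` (which is taken finite in the theorem):
a finite set of productions `A ::= e`. -/
structure Grammar (V : Type u) (N : Type v) where
  productions : Finset (N × ExtExp V N)

section Grammar

variable {V : Type u} {N : Type v} (Γ : Grammar V N)

/-- The derivation relation `e ⇒*_Γ t` between extended and pure expressions. -/
inductive Derives : ExtExp V N → PureExp V → Prop
  | subst (e : ExtExp V N) (τ : e.Occ → PureExp V)
      (h : ∀ i : e.Occ, Derives (.nt (e.occName i)) (τ i)) : Derives e (e.subst τ)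
  | prod {A : N} {e : ExtExp V N} {t : PureExp V}
      (hA : (A, e) ∈ Γ.productions) (h : Derives e t) : Derives (.nt A) t

/-- Free variables of an extended expression. -/
def extFv (e : ExtExp V N) : Set V := {x | ∃ t : PureExp V, Derives Γ e t ∧ x ∈ t.fv}

/-- An extended expression is closed iff all pure expressions derived from it are.
An extended program is a closed extended expression. -/
def ExtClosed (e : ExtExp V N) : Prop := ∀ t : PureExp V, Derives Γ e t → t.Closed

/-- `IsSubexp Γ t e` means `t ∈ subexps(e)`. -/
inductive IsSubexp : ExtExp V N → ExtExp V N → Prop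
  | refl (e : ExtExp V N) : IsSubexp e e
  | lam {t : ExtExp V N} {x : V} {e : ExtExp V N} (h : IsSubexp t e) : IsSubexp t (.lam x e)
  | appLeft {t e₁ e₂ : ExtExp V N} (h : IsSubexp t e₁) : IsSubexp t (.app e₁ e₂)
  | appRight {t e₁ e₂ : ExtExp V N} (h : IsSubexp t e₂) : IsSubexp t (.app e₁ e₂)
  | prod {t : ExtExp V N} {A : N} {e : ExtExp V N}
      (hA : (A, e) ∈ Γ.productions) (h : IsSubexp t e) : IsSubexp t (.nt A)

end Grammar

/-! ## Exact environment-based semantics of the pure calculus -/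

/-- Values are closures `λx.e : ρ`, where the environment `ρ` is a map from a finite set `dom`
of variables, containing the free variables of `λx.e`, to values. -/
inductive Value (V : Type u) : Type u
  | clo (x : V) (e : PureExp V) (dom : Finset V) (val : {y // y ∈ dom} → Value V)
      (hfv : (PureExp.lam x e).fv ⊆ ↑dom) : Value V

/-- Environments: maps from a finite set of variables to values. -/
structure Env (V : Type u) : Type u where
  dom : Finset V
  val : {y // y ∈ dom} → Value V

/-- The empty environment `[]`. -/
def Env.empty {V : Type u} : Env V := ⟨∅, fun y => absurd y.2 (Finset.notMem_empty y.1)⟩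

/-- The environment `ρ[x ↦ v]`. -/
def Env.update {V : Type u} [DecidableEq V] (ρ : Env V) (x : V) (v : Value V) : Env V where
  dom := insert x ρ.dom
  val := fun y => if h : y.1 = x then v else ρ.val ⟨y.1, Finset.mem_of_mem_insert_of_ne y.2 h⟩

/-- States `e : ρ` with `fv(e) ⊆ dom(ρ)`. -/
structure State (V : Type u) : Type u where
  exp : PureExp V
  env : Env V
  hfv : exp.fv ⊆ ↑env.dom

/-- The state `Q : []` of a closed pure expression `Q`. -/
def initState {V : Type u} (Q : PureExp V) (hQ : Q.Closed) : State V :=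
  ⟨Q, Env.empty, by rw [show Q.fv = ∅ from hQ]; exact Set.empty_subset _⟩

theorem fv_left {V : Type u} {e₁ e₂ : PureExp V} {S : Set V} (h : (PureExp.app e₁ e₂).fv ⊆ S) :
    e₁.fv ⊆ S := Set.subset_union_left.trans h

theorem fv_right {V : Type u} {e₁ e₂ : PureExp V} {S : Set V} (h : (PureExp.app e₁ e₂).fv ⊆ S) :
    e₂.fv ⊆ S := Set.subset_union_right.trans h

theorem fv_body {V : Type u} [DecidableEq V] {x : V} {e : PureExp V} {D : Finset V}
    (h : (PureExp.lam x e).fv ⊆ ↑D) : e.fv ⊆ ↑(insert x D) := by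
  intro y hy
  by_cases hyx : y = x
  · subst hyx; simp
  · have := h (show y ∈ (PureExp.lam x e).fv from ⟨hy, hyx⟩)
    simp only [Finset.coe_insert]
    exact Set.mem_insert_of_mem _ this

/-- The kinds of calls: operator, operand, function call, nonterminal (extended calculus only). -/
inductive CallKind
  | r | d | c | n

mutual
/-- Exact evaluation `s ⇓ v`. -/
inductive Eval {V : Type u} [DecidableEq V] : State V → Value V → Prop
  | value (x : V) (e : PureExp V) (ρ : Env V) (h : (PureExp.lam x e).fv ⊆ ↑ρ.dom) :
      Eval ⟨.lam x e, ρ, h⟩ (.clo x e ρ.dom ρ.val h)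
  | var (x : V) (ρ : Env V) (h : (PureExp.var x).fv ⊆ ↑ρ.dom) :
      Eval ⟨.var x, ρ, h⟩ (ρ.val ⟨x, h rfl⟩)
  | apply {e₁ e₂ : PureExp V} {ρ : Env V} {h : (PureExp.app e₁ e₂).fv ⊆ ↑ρ.dom}
      {s' : State V} {w : Value V}
      (hc : Call .c ⟨.app e₁ e₂, ρ, h⟩ s') (he : Eval s' w) : Eval ⟨.app e₁ e₂, ρ, h⟩ w

/-- Exact calls `s → s'` of kinds `r`, `d`, `c`. -/
inductive Call {V : Type u} [DecidableEq V] : CallKind → State V → State V → Prop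
  | operator (e₁ e₂ : PureExp V) (ρ : Env V) (h : (PureExp.app e₁ e₂).fv ⊆ ↑ρ.dom) :
      Call .r ⟨.app e₁ e₂, ρ, h⟩ ⟨e₁, ρ, fv_left h⟩
  | operand {e₁ e₂ : PureExp V} {ρ : Env V} {h : (PureExp.app e₁ e₂).fv ⊆ ↑ρ.dom}
      {v₁ : Value V} (h₁ : Eval ⟨e₁, ρ, fv_left h⟩ v₁) :
      Call .d ⟨.app e₁ e₂, ρ, h⟩ ⟨e₂, ρ, fv_right h⟩
  | call {e₁ e₂ : PureExp V} {ρ : Env V} {h : (PureExp.app e₁ e₂).fv ⊆ ↑ρ.dom}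
      {x : V} {e₀ : PureExp V} {ρ₀ : Env V} {h₀ : (PureExp.lam x e₀).fv ⊆ ↑ρ₀.dom}
      {v₂ : Value V}
      (h₁ : Eval ⟨e₁, ρ, fv_left h⟩ (.clo x e₀ ρ₀.dom ρ₀.val h₀))
      (h₂ : Eval ⟨e₂, ρ, fv_right h⟩ v₂) :
      Call .c ⟨.app e₁ e₂, ρ, h⟩ ⟨e₀, ρ₀.update x v₂, fv_body h₀⟩
end

/-- `Q : [] ⇓`, i.e. `Q` is closed and its evaluation terminates with some value. -/
def Terminates {V : Type u} [DecidableEq V] (Q : PureExp V) : Prop :=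
  ∃ (hQ : Q.Closed) (w : Value V), Eval (initState Q hQ) w

/-- An infinite call sequence `Q : [] = s₀ → s₁ → s₂ → …` in the exact semantics. -/
structure IsInfiniteCallSeq {V : Type u} [DecidableEq V] (Q : PureExp V) (hQ : Q.Closed)
    (s : ℕ → State V) : Prop where
  start : s 0 = initState Q hQ
  step : ∀ i, ∃ k, Call k (s i) (s (i + 1))

/-- `P` is `Γ`-terminating: every pure expression obtained from `P` by replacing each occurrence
of a nonterminal by a pure expression derivable from it terminates. -/
def GammaTerminating {V : Type u} {N : Type v} [DecidableEq V] (Γ : Grammar V N)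
    (P : ExtExp V N) : Prop :=
  ∀ τ : P.Occ → PureExp V, (∀ i, Derives Γ (.nt (P.occName i)) (τ i)) → Terminates (P.subst τ)

/-! ## Size-change graphs -/

/-- Graph nodes: variables and the empty name path `ε`. -/
inductive Node (V : Type u) : Type u
  | eps : Node V
  | var (x : V) : Node V

/-- Arc labels `=` and `↓`. -/
inductive Label
  | eq | down

/-- A size-change graph is given by its set of labelled arcs. The graph `G` of a judgement about
`e` and `e'` has source `fv(e) ∪ {ε}` and target `fv(e') ∪ {ε}`. -/
abbrev Graph (V : Type u) : Type u := Set (Node V × Label × Node V)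

section Graphs

variable {V : Type u} {N : Type v}

/-- The labels on all two-arc paths from `p` through `G₁` and then `G₂` to `q`. -/
def pathLabels (G₁ G₂ : Graph V) (p q : Node V) : Set Label :=
  {l | ∃ (m : Node V) (r s : Label), (p, r, m) ∈ G₁ ∧ (m, s, q) ∈ G₂ ∧ (l = r ∨ l = s)}

/-- Composition `G₁ ; G₂`. -/
def Graph.comp (G₁ G₂ : Graph V) : Graph V :=
  {a | ∃ p q, a = (p, Label.down, q) ∧ Label.down ∈ pathLabels G₁ G₂ p q} ∪
  {a | ∃ p q, a = (p, Label.eq, q) ∧ pathLabels G₁ G₂ p q = {Label.eq}}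

/-- `id^=_e`. -/
def idEq (Γ : Grammar V N) (e : ExtExp V N) : Graph V :=
  {(.eps, .eq, .eps)} ∪ {a | ∃ y ∈ extFv Γ e, a = (.var y, .eq, .var y)}

/-- `id^↓_e`. -/
def idDown (Γ : Grammar V N) (e : ExtExp V N) : Graph V :=
  {(.eps, .down, .eps)} ∪ {a | ∃ y ∈ extFv Γ e, a = (.var y, .eq, .var y)}

/-- The graph of a variable evaluation `x ⇓ w`. -/
def varGraph (Γ : Grammar V N) (x : V) (w : ExtExp V N) : Graph V :=
  {(.var x, .eq, .eps)} ∪ {a | ∃ y ∈ extFv Γ w, a = (.var x, .down, .var y)}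

open Classical in
/-- `G^{-ε/λx.e₀}`. -/
noncomputable def dropEps (Γ : Grammar V N) (x : V) (e₀ : ExtExp V N) (G : Graph V) : Graph V :=
  if x ∈ extFv Γ e₀ then
    {a | ∃ y r z, (Node.var y, r, Node.var z) ∈ G ∧ a = (.var y, r, .var z)} ∪
    {a | ∃ r z, (Node.eps, r, Node.var z) ∈ G ∧ a = (.eps, .down, .var z)}
  else
    {a | ∃ y r z, (Node.var y, r, Node.var z) ∈ G ∧ a = (.var y, r, .var z)} ∪
    {a | ∃ r q, (Node.eps, r, q) ∈ G ∧ a = (.eps, .down, q)} ∪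
    {a | ∃ p r, (p, r, Node.eps) ∈ G ∧ a = (p, .down, .eps)}

/-- `G^{ε↦x}`. -/
def epsTo (x : V) (G : Graph V) : Graph V :=
  {a | ∃ y r, (Node.var y, r, Node.eps) ∈ G ∧ a = (.var y, r, .var x)} ∪
  {a | ∃ r, (Node.eps, r, Node.eps) ∈ G ∧ a = (.eps, .down, .var x)}

/-- `G ∪_e G'`: the arcs of `G ∪ G'` that end in `fv(e) ∪ {ε}`. -/
def unionRestrict (Γ : Grammar V N) (e : ExtExp V N) (G G' : Graph V) : Graph V :=
  {a | a ∈ G ∪ G' ∧ (a.2.2 = .eps ∨ ∃ y ∈ extFv Γ e, a.2.2 = .var y)}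

/-- The infinite multipath `G₀, G₁, …` has a thread of infinite descent: a sequence of arcs
`a_k → a_{k+1}` of `G_k` for all `k ≥ j` (some `j`), infinitely many of them labelled `↓`. -/
def HasInfinitelyDescendingThread (G : ℕ → Graph V) : Prop :=
  ∃ (j : ℕ) (a : ℕ → Node V) (r : ℕ → Label),
    (∀ k, j ≤ k → (a k, r k, a (k + 1)) ∈ G k) ∧ {k | j ≤ k ∧ r k = Label.down}.Infinite

end Graphs

/-! ## Approximate extended semantics with size-change graphs -/

mutual
/-- Approximate evaluation `e ⇓ w, G` relative to the program `P` under analysis. -/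
inductive AEval {V : Type u} {N : Type v} (Γ : Grammar V N) (P : ExtExp V N) :
    ExtExp V N → ExtExp V N → Graph V → Prop
  | value (x : V) (e : ExtExp V N) : AEval Γ P (.lam x e) (.lam x e) (idEq Γ (.lam x e))
  | var {x : V} {e₁ e₂ e₀ v₂ : ExtExp V N} {G₁ G₂ : Graph V}
      (hP : IsSubexp Γ (.app e₁ e₂) P)
      (h₁ : AEval Γ P e₁ (.lam x e₀) G₁) (h₂ : AEval Γ P e₂ v₂ G₂) :
      AEval Γ P (.var x) v₂ (varGraph Γ x v₂)
  | result {k : CallKind} {e e' w : ExtExp V N} {G' G : Graph V}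
      (hk : k = .c ∨ k = .n) (hc : ACall Γ P k e e' G') (he : AEval Γ P e' w G) :
      AEval Γ P e w (G'.comp G)

/-- Approximate calls `e → e', G` of kinds `r`, `d`, `c`, `n`. -/
inductive ACall {V : Type u} {N : Type v} (Γ : Grammar V N) (P : ExtExp V N) :
    CallKind → ExtExp V N → ExtExp V N → Graph V → Prop
  | gram {A : N} {e : ExtExp V N} (hA : (A, e) ∈ Γ.productions) :
      ACall Γ P .n (.nt A) e (idEq Γ e)
  | operator (e₁ e₂ : ExtExp V N) : ACall Γ P .r (.app e₁ e₂) e₁ (idDown Γ e₁)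
  | operand (e₁ e₂ : ExtExp V N) : ACall Γ P .d (.app e₁ e₂) e₂ (idDown Γ e₂)
  | call {e₁ e₂ e₀ v₂ : ExtExp V N} {x : V} {G₁ G₂ : Graph V}
      (h₁ : AEval Γ P e₁ (.lam x e₀) G₁) (h₂ : AEval Γ P e₂ v₂ G₂) :
      ACall Γ P .c (.app e₁ e₂) e₀ (unionRestrict Γ e₀ (dropEps Γ x e₀ G₁) (epsTo x G₂))
end

/-- An infinite call sequence `P = e₀ → e₁, G₀`, `e₁ → e₂, G₁`, … in the approximate extended
semantics of `P`. -/
structure IsApproxInfiniteCallSeq {V : Type u} {N : Type v} (Γ : Grammar V N) (P : ExtExp V N)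
    (e : ℕ → ExtExp V N) (G : ℕ → Graph V) : Prop where
  start : e 0 = P
  step : ∀ i, ∃ k, ACall Γ P k (e i) (e (i + 1)) (G i)

end LambdaSCT

/-!
Give the state `e : ρ` the natural number weight "size of `e`, plus the weight of `ρ(y)` for every
free occurrence of a variable `y` in `e`", where the weight of a value is its weight as a state.
Evaluation and calls of the exact semantics are simulated by those of the approximate semantics,
in such a way that the arcs of the size-change graphs bound the change of the weights of the state
(at `ε`) and of the values of its free variables: no arc increases weights, and `↓` decreases them.
An infinite exact call sequence therefore yields an infinite approximate one in which a thread of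
infinite descent would be an infinite descent in `ℕ`. Nontermination, finally, always comes with
an infinite call sequence, since a state evaluates as soon as all the states that it calls do.
-/

namespace LambdaSCT

universe u v w

/-! ## Derivations -/

section Derivations

variable {V : Type u} {N : Type v} {Γ : Grammar V N}

theorem Derives.exists_lam {x : V} {e : ExtExp V N} {t : PureExp V} (h : Derives Γ (.lam x e) t) :
    ∃ t₀, t = .lam x t₀ ∧ Derives Γ e t₀ := by
  cases h with
  | subst _ τ hτ => exact ⟨_, rfl, .subst e τ hτ⟩

theorem Derives.exists_app {e₁ e₂ : ExtExp V N} {t : PureExp V} (h : Derives Γ (.app e₁ e₂) t) :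
    ∃ t₁ t₂, t = .app t₁ t₂ ∧ Derives Γ e₁ t₁ ∧ Derives Γ e₂ t₂ := by
  cases h with
  | subst _ τ hτ =>
    exact ⟨_, _, rfl, .subst e₁ _ fun i => hτ (.inl i), .subst e₂ _ fun i => hτ (.inr i)⟩

theorem notMem_extFv_lam (x : V) (e : ExtExp V N) : x ∉ extFv Γ (.lam x e) := by
  rintro ⟨t, ht, hx⟩
  obtain ⟨t₀, rfl, -⟩ := ht.exists_lam
  exact hx.2 rfl

theorem IsSubexp.trans {a b c : ExtExp V N} (hab : IsSubexp Γ a b) (hbc : IsSubexp Γ b c) :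
    IsSubexp Γ a c := by
  induction hbc with
  | refl => exact hab
  | lam _ ih => exact .lam ih
  | appLeft _ ih => exact .appLeft ih
  | appRight _ ih => exact .appRight ih
  | prod hA _ ih => exact .prod hA ih

/-- `Unfolds Γ e e'` means that `e'` arises from `e` by repeatedly replacing a nonterminal by the
right-hand side of one of its productions, as long as the whole expression is a nonterminal. These
are the `n`-calls that the approximate semantics inserts before it can simulate an exact step. -/
inductive Unfolds (Γ : Grammar V N) : ExtExp V N → ExtExp V N → Prop
  | refl (e : ExtExp V N) : Unfolds Γ e e
  | step {A : N} {e e' : ExtExp V N} (hA : (A, e) ∈ Γ.productions) (hu : Unfolds Γ e e') :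
      Unfolds Γ (.nt A) e'

theorem Unfolds.isSubexp {e e' : ExtExp V N} (hu : Unfolds Γ e e') : IsSubexp Γ e' e := by
  induction hu with
  | refl => exact .refl _
  | step hA _ ih => exact .prod hA ih

theorem Unfolds.derives {e e' : ExtExp V N} {t : PureExp V} (hu : Unfolds Γ e e')
    (h : Derives Γ e' t) : Derives Γ e t := by
  induction hu with
  | refl => exact h
  | step hA _ ih => exact .prod hA (ih h)

theorem Derives.unfolds_var {e : ExtExp V N} {x : V} (h : Derives Γ e (.var x)) :
    Unfolds Γ e (.var x) := by
  generalize ht : PureExp.var x = t at h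
  induction h with
  | prod hA _ ih => exact .step hA (ih ht)
  | subst e τ _ ih =>
    cases e with
    | nt A => exact ih () ht
    | var y => cases ht; exact .refl _
    | app | lam => cases ht

theorem Derives.exists_unfolds_lam {e : ExtExp V N} {x : V} {t₀ : PureExp V}
    (h : Derives Γ e (.lam x t₀)) :
    ∃ e₀, Unfolds Γ e (.lam x e₀) ∧ Derives Γ e₀ t₀ := by
  generalize ht : PureExp.lam x t₀ = t at h
  induction h with
  | prod hA _ ih =>
    obtain ⟨e₀, hu, hd⟩ := ih ht
    exact ⟨e₀, .step hA hu, hd⟩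
  | subst e τ hτ ih =>
    cases e with
    | nt A => exact ih () ht
    | lam y e₀ => cases ht; exact ⟨e₀, .refl _, .subst e₀ τ hτ⟩
    | var | app => cases ht

theorem Derives.exists_unfolds_app {e : ExtExp V N} {t₁ t₂ : PureExp V}
    (h : Derives Γ e (.app t₁ t₂)) :
    ∃ e₁ e₂, Unfolds Γ e (.app e₁ e₂) ∧ Derives Γ (.app e₁ e₂) (.app t₁ t₂) := by
  generalize ht : PureExp.app t₁ t₂ = t at h ⊢
  induction h with
  | prod hA _ ih =>
    obtain ⟨e₁, e₂, hu, hd⟩ := ih ht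
    exact ⟨e₁, e₂, .step hA hu, hd⟩
  | subst e τ hτ ih =>
    cases e with
    | nt A => exact ih () ht
    | app e₁ e₂ => exact ⟨e₁, e₂, .refl _, .subst _ τ hτ⟩
    | var | lam => cases ht

end Derivations

/-! ## Safe size-change graphs -/

section SafeGraphs

variable {V : Type u} {N : Type v} {α : Type w}

section Preorder

variable [Preorder α]

/-- `G.Safe f g` is the safety of a size-change graph for the weights `f` of its source nodes and
`g` of its target nodes: weights do not increase along arcs, and decrease along those labelled
`↓`. -/
def Graph.Safe (G : Graph V) (f g : Node V → α) : Prop :=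
  ∀ ⦃p r q⦄, (p, r, q) ∈ G → g q ≤ f p ∧ (r = .down → g q < f p)

/-- The change of weights that is recorded by the graphs `id^↓_e`. -/
structure EpsDescent (f g : Node V → α) : Prop where
  eps : g .eps < f .eps
  var : ∀ y, g (.var y) ≤ f (.var y)

theorem EpsDescent.le {f g : Node V → α} (h : EpsDescent f g) : ∀ p, g p ≤ f p
  | .eps => h.eps.le
  | .var y => h.var y

theorem Graph.Safe.comp {G₁ G₂ : Graph V} {f g h : Node V → α} (h₁ : G₁.Safe f g)
    (h₂ : G₂.Safe g h) : (G₁.comp G₂).Safe f h := by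
  rintro p r q (⟨_, _, heq, m, _, _, hpm, hmq, hdown⟩ | ⟨_, _, heq, hlabels⟩) <;> cases heq
  · obtain ⟨hle₁, hlt₁⟩ := h₁ hpm
    obtain ⟨hle₂, hlt₂⟩ := h₂ hmq
    have hlt : h q < f p := by
      rcases hdown with rfl | rfl
      · exact hle₂.trans_lt (hlt₁ rfl)
      · exact (hlt₂ rfl).trans_le hle₁
    exact ⟨hlt.le, fun _ => hlt⟩
  · obtain ⟨m, _, _, hpm, hmq, -⟩ : Label.eq ∈ pathLabels G₁ G₂ p q := hlabels ▸ rfl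
    exact ⟨(h₂ hmq).1.trans (h₁ hpm).1, nofun⟩

theorem idEq_safe (Γ : Grammar V N) (e : ExtExp V N) (f : Node V → α) : (idEq Γ e).Safe f f := by
  rintro p r q (heq | ⟨y, -, heq⟩) <;> cases heq <;> exact ⟨le_rfl, nofun⟩

theorem idDown_safe (Γ : Grammar V N) (e : ExtExp V N) {f g : Node V → α}
    (h : EpsDescent f g) : (idDown Γ e).Safe f g := by
  rintro p r q (heq | ⟨y, -, heq⟩) <;> cases heq
  · exact ⟨h.eps.le, fun _ => h.eps⟩
  · exact ⟨h.var y, nofun⟩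

theorem varGraph_safe (Γ : Grammar V N) (e : ExtExp V N) {x : V} {f g : Node V → α}
    (heps : g .eps ≤ f (.var x)) (hvar : ∀ y, g (.var y) < g .eps) :
    (varGraph Γ x e).Safe f g := by
  rintro p r q (heq | ⟨y, -, heq⟩) <;> cases heq
  · exact ⟨heps, nofun⟩
  · have hlt := (hvar y).trans_le heps
    exact ⟨hlt.le, fun _ => hlt⟩

theorem unionRestrict_safe (Γ : Grammar V N) (e : ExtExp V N) {G G' : Graph V}
    {f g : Node V → α} (hG : G.Safe f g) (hG' : G'.Safe f g) :
    (unionRestrict Γ e G G').Safe f g := by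
  rintro p r q ⟨hmem | hmem, -⟩
  · exact hG hmem
  · exact hG' hmem

theorem dropEps_safe {Γ : Grammar V N} {x : V} {e₀ : ExtExp V N} {G : Graph V}
    {f f' g g' : Node V → α} (hG : G.Safe f g) (hf : EpsDescent f' f)
    (hvar : ∀ ⦃p r z⦄, (p, r, Node.var z) ∈ G → g' (.var z) ≤ g (.var z))
    (heps : x ∉ extFv Γ e₀ → g' .eps < g .eps) : (dropEps Γ x e₀ G).Safe f' g' := by
  have var_var {y r z} (h : (Node.var y, r, Node.var z) ∈ G) :
      g' (.var z) ≤ f' (.var y) ∧ (r = .down → g' (.var z) < f' (.var y)) :=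
    ⟨((hvar h).trans (hG h).1).trans (hf.var y),
      fun hr => ((hvar h).trans_lt ((hG h).2 hr)).trans_le (hf.var y)⟩
  have eps_var {r z} (h : (Node.eps, r, Node.var z) ∈ G) : g' (.var z) < f' .eps :=
    ((hvar h).trans (hG h).1).trans_lt hf.eps
  have to_eps (hx : x ∉ extFv Γ e₀) {p r} (h : (p, r, Node.eps) ∈ G) : g' .eps < f' p :=
    ((heps hx).trans_le (hG h).1).trans_le (hf.le p)
  intro p r q hmem
  unfold dropEps at hmem
  split_ifs at hmem with hx
  · rcases hmem with ⟨y, r, z, h, heq⟩ | ⟨r, z, h, heq⟩ <;> cases heq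
    · exact var_var h
    · exact ⟨(eps_var h).le, fun _ => eps_var h⟩
  · rcases hmem with (⟨y, r, z, h, heq⟩ | ⟨r, _ | z, h, heq⟩) | ⟨p, r, h, heq⟩ <;> cases heq
    · exact var_var h
    · exact ⟨(to_eps hx h).le, fun _ => to_eps hx h⟩
    · exact ⟨(eps_var h).le, fun _ => eps_var h⟩
    · exact ⟨(to_eps hx h).le, fun _ => to_eps hx h⟩

theorem epsTo_safe {x : V} {G : Graph V} {f f' g g' : Node V → α} (hG : G.Safe f g)
    (hf : EpsDescent f' f) (hx : g' (.var x) ≤ g .eps) : (epsTo x G).Safe f' g' := by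
  rintro p r q (⟨y, r, h, heq⟩ | ⟨r, h, heq⟩) <;> cases heq
  · exact ⟨(hx.trans (hG h).1).trans (hf.var y),
      fun hr => (hx.trans_lt ((hG h).2 hr)).trans_le (hf.var y)⟩
  · have hlt := (hx.trans (hG h).1).trans_lt hf.eps
    exact ⟨hlt.le, fun _ => hlt⟩

end Preorder

theorem not_hasInfinitelyDescendingThread_of_safe [PartialOrder α] [WellFoundedLT α]
    {G : ℕ → Graph V} {f : ℕ → Node V → α} (hG : ∀ i, (G i).Safe (f i) (f (i + 1))) :
    ¬ HasInfinitelyDescendingThread G := by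
  rintro ⟨j, a, r, harc, hinf⟩
  have hanti : Antitone fun k => f (j + k) (a (j + k)) :=
    antitone_nat_of_succ_le fun k => (hG _ (harc _ (Nat.le_add_right j k))).1
  obtain ⟨n, hconst⟩ := WellFoundedLT.antitone_chain_condition hanti
  obtain ⟨k, ⟨hjk, hdown⟩, hk⟩ := hinf.exists_gt (j + n)
  obtain ⟨m, rfl⟩ := Nat.exists_eq_add_of_le hjk
  have hlt : f (j + m + 1) (a (j + m + 1)) < f (j + m) (a (j + m)) :=
    (hG _ (harc _ hjk)).2 hdown
  exact hlt.ne ((hconst (m + 1) (by lia)).symm.trans (hconst m (by lia)))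

/-- The arcs of `G` to variables end in `S`. -/
def Graph.EndsIn (G : Graph V) (S : Set V) : Prop :=
  ∀ ⦃p r z⦄, (p, r, Node.var z) ∈ G → z ∈ S

theorem Graph.EndsIn.comp {G₂ : Graph V} {S : Set V} (h : G₂.EndsIn S) (G₁ : Graph V) :
    (G₁.comp G₂).EndsIn S := by
  rintro p r z (⟨_, _, heq, m, _, _, -, hmz, -⟩ | ⟨_, _, heq, hlabels⟩) <;> cases heq
  · exact h hmz
  · obtain ⟨m, _, _, -, hmz, -⟩ : Label.eq ∈ pathLabels G₁ G₂ p (.var z) := hlabels ▸ rfl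
    exact h hmz

theorem AEval.endsIn {Γ : Grammar V N} {P e w : ExtExp V N} {G : Graph V} :
    AEval Γ P e w G → G.EndsIn (extFv Γ w)
  | .value x e => by
    rintro p r z (heq | ⟨y, hy, heq⟩) <;> cases heq
    exact hy
  | .var _ _ _ => by
    rintro p r z (heq | ⟨y, hy, heq⟩) <;> cases heq
    exact hy
  | .result _ _ he => he.endsIn.comp _

end SafeGraphs

/-! ## Weights -/

section Weights

variable {V : Type u} [DecidableEq V]

/-- The size of a pure expression in which every free occurrence of a variable `y` counts `w y`
more. -/
def PureExp.weight : PureExp V → (V → ℕ) → ℕ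
  | .var x, w => w x + 1
  | .app e₁ e₂, w => e₁.weight w + e₂.weight w + 1
  | .lam x e, w => e.weight (Function.update w x 0) + 1

theorem PureExp.weight_pos (e : PureExp V) (w : V → ℕ) : 0 < e.weight w := by
  cases e <;> exact Nat.succ_pos _

theorem PureExp.weight_congr {e : PureExp V} {w w' : V → ℕ} (h : Set.EqOn w w' e.fv) :
    e.weight w = e.weight w' := by
  induction e generalizing w w' with
  | var x => simp only [weight, h rfl]
  | app e₁ e₂ ih₁ ih₂ =>
    simp only [weight, ih₁ (h.mono Set.subset_union_left), ih₂ (h.mono Set.subset_union_right)]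
  | lam x e ih =>
    have hupdate : Set.EqOn (Function.update w x 0) (Function.update w' x 0) e.fv := by
      intro y hy
      by_cases hyx : y = x
      · simp only [hyx, Function.update_self]
      · simp only [Function.update_of_ne hyx, h ⟨hy, hyx⟩]
    simp only [weight, ih hupdate]

theorem PureExp.lt_weight_of_mem_fv {e : PureExp V} {y : V} (hy : y ∈ e.fv) (w : V → ℕ) :
    w y < e.weight w := by
  induction e generalizing w with
  | var x =>
    obtain rfl : y = x := hy
    exact Nat.lt_succ_self _
  | app e₁ e₂ ih₁ ih₂ =>
    simp only [weight]
    rcases hy with hy | hy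
    · have := ih₁ hy w
      lia
    · have := ih₂ hy w
      lia
  | lam x e ih =>
    have := ih hy.1 (Function.update w x 0)
    rw [Function.update_of_ne hy.2] at this
    exact this.trans (Nat.lt_succ_self _)

theorem PureExp.weight_update_lt_weight_lam {e : PureExp V} {x : V} (hx : x ∉ e.fv)
    (w : V → ℕ) (n : ℕ) : e.weight (Function.update w x n) < (PureExp.lam x e).weight w := by
  have hupdate : Set.EqOn (Function.update w x n) (Function.update w x 0) e.fv := by
    intro y hy
    have hyx : y ≠ x := fun hyx => hx (hyx ▸ hy)
    simp only [Function.update_of_ne hyx]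
  rw [weight_congr hupdate]
  exact Nat.lt_succ_self _

/-- The weights of the nodes of a size-change graph at a pure expression `e`: that of `e` at `ε`,
and `w y` at `y`. Derivable expressions may lack free variables of the extended expression, and
variables that do not occur free in `e` get weight `0`, so that all variables weigh less
than `ε`. -/
noncomputable def PureExp.nodeWeight (e : PureExp V) (w : V → ℕ) : Node V → ℕ
  | .eps => e.weight w
  | .var y => e.fv.indicator w y

theorem PureExp.nodeWeight_var_lt_nodeWeight_eps (e : PureExp V) (w : V → ℕ) (y : V) :
    e.nodeWeight w (.var y) < e.nodeWeight w .eps := by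
  by_cases hy : y ∈ e.fv
  · exact (Set.indicator_of_mem hy w).trans_lt (lt_weight_of_mem_fv hy w)
  · exact (Set.indicator_of_notMem hy w).trans_lt (e.weight_pos w)

theorem PureExp.epsDescent_app_left (e₁ e₂ : PureExp V) (w : V → ℕ) :
    EpsDescent ((PureExp.app e₁ e₂).nodeWeight w) (e₁.nodeWeight w) where
  eps := by simp only [nodeWeight, weight]; lia
  var := Set.indicator_le_indicator_of_subset Set.subset_union_left fun _ => Nat.zero_le _

theorem PureExp.epsDescent_app_right (e₁ e₂ : PureExp V) (w : V → ℕ) :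
    EpsDescent ((PureExp.app e₁ e₂).nodeWeight w) (e₂.nodeWeight w) where
  eps := by simp only [nodeWeight, weight]; lia
  var := Set.indicator_le_indicator_of_subset Set.subset_union_right fun _ => Nat.zero_le _

theorem PureExp.nodeWeight_var_update_le (e : PureExp V) (w : V → ℕ) (n : ℕ) {x z : V}
    (hz : z ≠ x) :
    e.nodeWeight (Function.update w x n) (.var z) ≤ (PureExp.lam x e).nodeWeight w (.var z) := by
  refine Set.indicator_apply_le' (fun hmem => ?_) fun _ => Nat.zero_le _
  have hmem' : z ∈ (PureExp.lam x e).fv := ⟨hmem, hz⟩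
  rw [nodeWeight, Set.indicator_of_mem hmem', Function.update_of_ne hz]

theorem callGraph_safe {N : Type v} {Γ : Grammar V N} {x : V} {e₀ : ExtExp V N}
    {t₀ t₁ t₂ : PureExp V} {G₁ G₂ : Graph V} {w w₀ : V → ℕ} {g : Node V → ℕ}
    (hd : Derives Γ e₀ t₀) (hend : G₁.EndsIn (extFv Γ (.lam x e₀)))
    (h₁ : G₁.Safe (t₁.nodeWeight w) ((PureExp.lam x t₀).nodeWeight w₀))
    (h₂ : G₂.Safe (t₂.nodeWeight w) g) :
    (unionRestrict Γ e₀ (dropEps Γ x e₀ G₁) (epsTo x G₂)).Safe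
      ((PureExp.app t₁ t₂).nodeWeight w)
      (t₀.nodeWeight (Function.update w₀ x (g .eps))) := by
  apply unionRestrict_safe
  · refine dropEps_safe h₁ (t₁.epsDescent_app_left t₂ w) (fun p r z hmem => ?_) fun hx => ?_
    · have hzx : z ≠ x := fun hzx => notMem_extFv_lam x e₀ (hzx ▸ hend hmem)
      exact t₀.nodeWeight_var_update_le w₀ _ hzx
    · exact PureExp.weight_update_lt_weight_lam (fun hmem => hx ⟨t₀, hd, hmem⟩) w₀ _
  · refine epsTo_safe h₂ (t₁.epsDescent_app_right t₂ w) ?_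
    exact Set.indicator_apply_le' (fun _ => (Function.update_self ..).le) fun _ => Nat.zero_le _

/-- The weight of a value, which is that of the value regarded as a state. -/
def Value.weight : Value V → ℕ
  | .clo x e dom val _ =>
    (PureExp.lam x e).weight fun y => if h : y ∈ dom then (val ⟨y, h⟩).weight else 0

/-- The weights of the values of the variables, with the junk value `0` outside the domain. -/
def Env.weight (ρ : Env V) (y : V) : ℕ :=
  if h : y ∈ ρ.dom then (ρ.val ⟨y, h⟩).weight else 0

theorem Env.weight_update (ρ : Env V) (x : V) (v : Value V) :
    (ρ.update x v).weight = Function.update ρ.weight x v.weight := by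
  funext y
  by_cases hyx : y = x
  · subst hyx
    simp [Env.weight, Env.update]
  · simp [Env.weight, Env.update, hyx]

/-- The weights of the nodes at a state. -/
noncomputable abbrev State.nodeWeight (s : State V) : Node V → ℕ :=
  s.exp.nodeWeight s.env.weight

/-- The weights of the nodes at a value, regarded as a state. -/
noncomputable def Value.nodeWeight : Value V → Node V → ℕ
  | .clo x e dom val _ => (PureExp.lam x e).nodeWeight (Env.weight ⟨dom, val⟩)

theorem Value.nodeWeight_eps (v : Value V) : v.nodeWeight .eps = v.weight := by
  cases v
  rw [Value.weight]
  rfl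

theorem Value.nodeWeight_var_lt_nodeWeight_eps (v : Value V) (y : V) :
    v.nodeWeight (.var y) < v.nodeWeight .eps := by
  cases v
  exact PureExp.nodeWeight_var_lt_nodeWeight_eps _ _ y

theorem State.nodeWeight_var_self {x : V} {ρ : Env V} (h : (PureExp.var x).fv ⊆ ↑ρ.dom) :
    (State.mk (.var x) ρ h).nodeWeight (.var x) = (ρ.val ⟨x, h rfl⟩).weight :=
  (Set.indicator_of_mem (Set.mem_singleton x) _).trans (dif_pos _)

end Weights

/-! ## Simulation of the exact semantics -/

section Simulation

variable {V : Type u} {N : Type v} (Γ : Grammar V N) (P : ExtExp V N)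

/-- The approximate semantics, which has no environments, may bind `y` to `w`: this is the premise
of the rule for the evaluation of the variable `y`. -/
def MayBind (y : V) (w : ExtExp V N) : Prop :=
  ∃ e₁ e₂ e₀ G₁ G₂, IsSubexp Γ (.app e₁ e₂) P ∧ AEval Γ P e₁ (.lam y e₀) G₁ ∧ AEval Γ P e₂ w G₂

/-- The value `v` of the exact semantics is represented by the extended expression `w`, and
hereditarily so are the values in its environment. -/
def AbstractsValue : ExtExp V N → Value V → Prop
  | w, .clo x t dom val _ => ∃ e, w = .lam x e ∧ IsSubexp Γ w P ∧ Derives Γ e t ∧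
      ∀ y : {y // y ∈ dom}, ∃ w', MayBind Γ P y.1 w' ∧ AbstractsValue w' (val y)

/-- All bindings of `ρ` are represented by bindings of the approximate semantics. -/
def AbstractsEnv (ρ : Env V) : Prop :=
  ∀ y : {y // y ∈ ρ.dom}, ∃ w, MayBind Γ P y.1 w ∧ AbstractsValue Γ P w (ρ.val y)

/-- The state `s` of the exact semantics is represented by the extended expression `e`. -/
structure Abstracts (e : ExtExp V N) (s : State V) : Prop where
  isSubexp : IsSubexp Γ e P
  derives : Derives Γ e s.exp
  env : AbstractsEnv Γ P s.env

variable {Γ P}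

theorem AbstractsEnv.update [DecidableEq V] {ρ : Env V} (hρ : AbstractsEnv Γ P ρ) {x : V}
    {w : ExtExp V N} {v : Value V} (hb : MayBind Γ P x w) (hw : AbstractsValue Γ P w v) :
    AbstractsEnv Γ P (ρ.update x v) := by
  rintro ⟨y, hy⟩
  by_cases hyx : y = x
  · subst hyx
    exact ⟨w, hb, by simpa [Env.update] using hw⟩
  · simpa [Env.update, hyx] using hρ ⟨y, Finset.mem_of_mem_insert_of_ne hy hyx⟩

theorem Abstracts.of_unfolds {e e' : ExtExp V N} {s : State V} (h : Abstracts Γ P e s)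
    (hu : Unfolds Γ e e') (hd : Derives Γ e' s.exp) : Abstracts Γ P e' s :=
  ⟨hu.isSubexp.trans h.isSubexp, hd, h.env⟩

theorem Abstracts.initState {Q : PureExp V} (hQ : Q.Closed) (hd : Derives Γ P Q) :
    Abstracts Γ P P (initState Q hQ) :=
  ⟨.refl P, hd, fun y => absurd y.2 (Finset.notMem_empty y.1)⟩

section Application

variable {e₁ e₂ : ExtExp V N} {t₁ t₂ : PureExp V} {ρ : Env V}
  {h : (PureExp.app t₁ t₂).fv ⊆ ↑ρ.dom}

theorem Abstracts.app_left (ha : Abstracts Γ P (.app e₁ e₂) ⟨.app t₁ t₂, ρ, h⟩) :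
    Abstracts Γ P e₁ ⟨t₁, ρ, fv_left h⟩ := by
  obtain ⟨_, _, heq, hd, -⟩ := ha.derives.exists_app
  cases heq
  exact ⟨(IsSubexp.appLeft (.refl _)).trans ha.isSubexp, hd, ha.env⟩

theorem Abstracts.app_right (ha : Abstracts Γ P (.app e₁ e₂) ⟨.app t₁ t₂, ρ, h⟩) :
    Abstracts Γ P e₂ ⟨t₂, ρ, fv_right h⟩ := by
  obtain ⟨_, _, heq, -, hd⟩ := ha.derives.exists_app
  cases heq
  exact ⟨(IsSubexp.appRight (.refl _)).trans ha.isSubexp, hd, ha.env⟩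

end Application

variable [DecidableEq V]

variable (Γ P) in
/-- The approximate semantics has a safe evaluation of `e` to a representative of `v`. -/
def SimulatesEval (e : ExtExp V N) (s : State V) (v : Value V) : Prop :=
  ∃ w G, AEval Γ P e w G ∧ AbstractsValue Γ P w v ∧ G.Safe s.nodeWeight v.nodeWeight

variable (Γ P) in
/-- The approximate semantics has a safe call of kind `k` from `e` to a representative of `s'`. -/
def SimulatesCall (k : CallKind) (e : ExtExp V N) (s s' : State V) : Prop :=
  ∃ e' G, ACall Γ P k e e' G ∧ Abstracts Γ P e' s' ∧ G.Safe s.nodeWeight s'.nodeWeight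

theorem SimulatesEval.of_unfolds {e e' : ExtExp V N} {s : State V} {v : Value V}
    (hu : Unfolds Γ e e') (h : SimulatesEval Γ P e' s v) : SimulatesEval Γ P e s v := by
  induction hu with
  | refl => exact h
  | step hA _ ih =>
    obtain ⟨w, G, heval, hw, hG⟩ := ih h
    exact ⟨w, _, .result (.inr rfl) (.gram hA) heval, hw, (idEq_safe Γ _ _).comp hG⟩

theorem SimulatesCall.simulatesEval {e : ExtExp V N} {s s' : State V} {v : Value V}
    (hc : SimulatesCall Γ P .c e s s')
    (he : ∀ e', Abstracts Γ P e' s' → SimulatesEval Γ P e' s' v) : SimulatesEval Γ P e s v := by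
  obtain ⟨e', G', hcall, ha', hG'⟩ := hc
  obtain ⟨w, G, heval, hw, hG⟩ := he e' ha'
  exact ⟨w, _, .result (.inl rfl) hcall heval, hw, hG'.comp hG⟩

theorem Abstracts.simulatesEval_lam {e : ExtExp V N} {x : V} {t : PureExp V} {ρ : Env V}
    {h : (PureExp.lam x t).fv ⊆ ↑ρ.dom} (ha : Abstracts Γ P e ⟨.lam x t, ρ, h⟩) :
    SimulatesEval Γ P e ⟨.lam x t, ρ, h⟩ (.clo x t ρ.dom ρ.val h) := by
  obtain ⟨e₀, hu, hd⟩ := ha.derives.exists_unfolds_lam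
  have hw : AbstractsValue Γ P (.lam x e₀) (.clo x t ρ.dom ρ.val h) :=
    ⟨e₀, rfl, hu.isSubexp.trans ha.isSubexp, hd, ha.env⟩
  exact .of_unfolds hu ⟨_, _, .value x e₀, hw, idEq_safe Γ _ _⟩

theorem Abstracts.simulatesEval_var {e : ExtExp V N} {x : V} {ρ : Env V}
    {h : (PureExp.var x).fv ⊆ ↑ρ.dom} (ha : Abstracts Γ P e ⟨.var x, ρ, h⟩) :
    SimulatesEval Γ P e ⟨.var x, ρ, h⟩ (ρ.val ⟨x, h rfl⟩) := by
  obtain ⟨w, ⟨e₁, e₂, e₀, G₁, G₂, hsub, h₁, h₂⟩, hw⟩ := ha.env ⟨x, h rfl⟩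
  have heps := (Value.nodeWeight_eps _).trans (State.nodeWeight_var_self h).symm
  exact .of_unfolds ha.derives.unfolds_var ⟨w, _, .var hsub h₁ h₂, hw,
    varGraph_safe Γ w heps.le (Value.nodeWeight_var_lt_nodeWeight_eps _)⟩

theorem Abstracts.simulatesCall_call {e₁ e₂ : ExtExp V N} {t₁ t₂ t₀ : PureExp V}
    {ρ ρ₀ : Env V} {x : V} {h : (PureExp.app t₁ t₂).fv ⊆ ↑ρ.dom}
    {h₀ : (PureExp.lam x t₀).fv ⊆ ↑ρ₀.dom} {v₂ : Value V}
    (ha : Abstracts Γ P (.app e₁ e₂) ⟨.app t₁ t₂, ρ, h⟩)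
    (h₁ : SimulatesEval Γ P e₁ ⟨t₁, ρ, fv_left h⟩ (.clo x t₀ ρ₀.dom ρ₀.val h₀))
    (h₂ : SimulatesEval Γ P e₂ ⟨t₂, ρ, fv_right h⟩ v₂) :
    SimulatesCall Γ P .c (.app e₁ e₂) ⟨.app t₁ t₂, ρ, h⟩ ⟨t₀, ρ₀.update x v₂, fv_body h₀⟩ := by
  obtain ⟨_, G₁, heval₁, ⟨e₀, rfl, hsub, hd, henv⟩, hG₁⟩ := h₁
  obtain ⟨w₂, G₂, heval₂, hw₂, hG₂⟩ := h₂
  have hb : MayBind Γ P x w₂ := ⟨e₁, e₂, e₀, G₁, G₂, ha.isSubexp, heval₁, heval₂⟩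
  refine ⟨e₀, _, .call heval₁ heval₂,
    ⟨(IsSubexp.lam (.refl _)).trans hsub, hd, AbstractsEnv.update henv hb hw₂⟩, ?_⟩
  rw [State.nodeWeight, State.nodeWeight, Env.weight_update, ← Value.nodeWeight_eps]
  exact callGraph_safe hd heval₁.endsIn hG₁ hG₂

mutual

theorem Eval.simulates {s : State V} {v : Value V} {e : ExtExp V N} :
    Eval s v → Abstracts Γ P e s → SimulatesEval Γ P e s v
  | .value .., ha => ha.simulatesEval_lam
  | .var .., ha => ha.simulatesEval_var
  | .apply hc he, ha =>
    have ⟨_, _, hu, hd⟩ := ha.derives.exists_unfolds_app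
    .of_unfolds hu <|
      (hc.simulates (ha.of_unfolds hu hd)).simulatesEval fun _ ha' => he.simulates ha'

theorem Call.simulates {k : CallKind} {s s' : State V} {e₁ e₂ : ExtExp V N} :
    Call k s s' → Abstracts Γ P (.app e₁ e₂) s → SimulatesCall Γ P k (.app e₁ e₂) s s'
  | .operator t₁ t₂ _ _, ha =>
    ⟨e₁, _, .operator e₁ e₂, ha.app_left, idDown_safe Γ e₁ (t₁.epsDescent_app_left t₂ _)⟩
  | .operand (e₁ := t₁) (e₂ := t₂) _, ha =>
    ⟨e₂, _, .operand e₁ e₂, ha.app_right, idDown_safe Γ e₂ (t₁.epsDescent_app_right t₂ _)⟩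
  | .call h₁ h₂, ha =>
    ha.simulatesCall_call (h₁.simulates ha.app_left) (h₂.simulates ha.app_right)

end

end Simulation

/-! ## Infinite call sequences -/

section InfiniteCallSequences

variable {V : Type u} {N : Type v} [DecidableEq V]

/-- `s'` is called by `s`. The caller comes second, so that accessibility of a state is the absence
of infinite call sequences from it. -/
def CalledBy (s' s : State V) : Prop := ∃ k, Call k s s'

/-- `c'.1` is called by `c.1` in the approximate semantics, with a graph that is safe for the
weights of the states `c.2` and `c'.2` represented by the two expressions. The caller comes second,
as in `CalledBy`. -/
def SafelyCalledBy (Γ : Grammar V N) (P : ExtExp V N) (c' c : ExtExp V N × State V) : Prop :=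
  ∃ G : Graph V, (∃ k, ACall Γ P k c.1 c'.1 G) ∧ G.Safe c.2.nodeWeight c'.2.nodeWeight

theorem exists_eval_of_forall_calledBy {s : State V} (h : ∀ s', CalledBy s' s → ∃ v, Eval s' v) :
    ∃ v, Eval s v := by
  obtain ⟨e, ρ, hfv⟩ := s
  cases e with
  | var x => exact ⟨_, .var x ρ hfv⟩
  | lam x e => exact ⟨_, .value x e ρ hfv⟩
  | app e₁ e₂ =>
    obtain ⟨⟨x, e₀, dom, val, h₀⟩, h₁⟩ := h _ ⟨_, .operator e₁ e₂ ρ hfv⟩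
    obtain ⟨v₂, h₂⟩ := h _ ⟨_, .operand h₁⟩
    have hc := Call.call (h := hfv) (ρ₀ := ⟨dom, val⟩) h₁ h₂
    obtain ⟨v, hv⟩ := h _ ⟨_, hc⟩
    exact ⟨v, .apply hc hv⟩

theorem exists_eval_of_acc {s : State V} (h : Acc CalledBy s) : ∃ v, Eval s v := by
  induction h with
  | intro s _ ih => exact exists_eval_of_forall_calledBy ih

theorem Call.exists_exp_eq_app {k : CallKind} {s s' : State V} (h : Call k s s') :
    ∃ t₁ t₂, s.exp = .app t₁ t₂ := by
  cases h <;> exact ⟨_, _, rfl⟩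

variable {Γ : Grammar V N} {P : ExtExp V N}

theorem Abstracts.exists_safelyCalledBy {e : ExtExp V N} {s s' : State V}
    (ha : Abstracts Γ P e s) (hs : CalledBy s' s) :
    ∃ e', (SafelyCalledBy Γ P (e', s) (e, s) ∧ Abstracts Γ P e' s) ∨
      (SafelyCalledBy Γ P (e', s') (e, s) ∧ Abstracts Γ P e' s') := by
  obtain ⟨k, hc⟩ := hs
  obtain ⟨t₁, t₂, ht⟩ := hc.exists_exp_eq_app
  obtain ⟨e₁, e₂, hu, hd⟩ := (ht ▸ ha.derives).exists_unfolds_app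
  cases hu with
  | refl =>
    obtain ⟨e', G, hcall, ha', hG⟩ := hc.simulates ha
    exact ⟨e', .inr ⟨⟨G, ⟨k, hcall⟩, hG⟩, ha'⟩⟩
  | @step A e' _ hA hu =>
    have hd' : Derives Γ e' s.exp := hu.derives (ht ▸ hd)
    exact ⟨e', .inl ⟨⟨_, ⟨.n, .gram hA⟩, idEq_safe Γ e' _⟩,
      ha.of_unfolds (.step hA (.refl e')) hd'⟩⟩

theorem Abstracts.acc_calledBy {e : ExtExp V N} {s : State V} (ha : Abstracts Γ P e s)
    (h : Acc (SafelyCalledBy Γ P) (e, s)) : Acc CalledBy s := by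
  generalize hc : (e, s) = c at h
  induction h generalizing e s with
  | intro c _ ih =>
    subst hc
    refine .intro s fun s' hs => ?_
    obtain ⟨e', ⟨hsafe, ha'⟩ | ⟨hsafe, ha'⟩⟩ := ha.exists_safelyCalledBy hs
    · exact (ih _ hsafe ha' rfl).inv hs
    · exact ih _ hsafe ha' rfl

theorem exists_approxInfiniteCallSeq_of_not_acc {s : State V}
    (h : ¬ Acc (SafelyCalledBy Γ P) (P, s)) :
    ∃ (e : ℕ → ExtExp V N) (G : ℕ → Graph V),
      IsApproxInfiniteCallSeq Γ P e G ∧ ¬ HasInfinitelyDescendingThread G := by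
  obtain ⟨c, hc₀, hc⟩ := not_acc_iff_exists_descending_chain.1 h
  choose G hcall hG using hc
  exact ⟨fun i => (c i).1, G, ⟨congrArg Prod.fst hc₀, hcall⟩,
    not_hasInfinitelyDescendingThread_of_safe hG⟩

theorem Derives.exists_approxInfiniteCallSeq {Q : PureExp V} (hd : Derives Γ P Q)
    (hQ : Q.Closed) (h : ¬ Acc CalledBy (initState Q hQ)) :
    ∃ (e : ℕ → ExtExp V N) (G : ℕ → Graph V),
      IsApproxInfiniteCallSeq Γ P e G ∧ ¬ HasInfinitelyDescendingThread G :=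
  exists_approxInfiniteCallSeq_of_not_acc fun hacc =>
    h ((Abstracts.initState hQ hd).acc_calledBy hacc)

theorem IsInfiniteCallSeq.not_acc {Q : PureExp V} {hQ : Q.Closed} {s : ℕ → State V}
    (hs : IsInfiniteCallSeq Q hQ s) : ¬ Acc CalledBy (initState Q hQ) :=
  not_acc_iff_exists_descending_chain.2 ⟨s, hs.start, hs.step⟩

end InfiniteCallSequences

end LambdaSCT

open LambdaSCT in
theorem mainTheorem4_general {V : Type*} [DecidableEq V] {N : Type*} (Γ : Grammar V N)
    (P : ExtExp V N) :
    ((∃ (Q : PureExp V) (hQ : Q.Closed), Derives Γ P Q ∧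
        ∃ s : ℕ → State V, IsInfiniteCallSeq Q hQ s) →
      ∃ (e : ℕ → ExtExp V N) (G : ℕ → Graph V),
        IsApproxInfiniteCallSeq Γ P e G ∧ ¬ HasInfinitelyDescendingThread G) ∧
    ((∀ (e : ℕ → ExtExp V N) (G : ℕ → Graph V),
        IsApproxInfiniteCallSeq Γ P e G → HasInfinitelyDescendingThread G) →
      ∀ Q : PureExp V, Q.Closed → Derives Γ P Q → Terminates Q) := by
  refine ⟨fun ⟨Q, hQ, hd, s, hs⟩ => hd.exists_approxInfiniteCallSeq hQ hs.not_acc,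
    fun hdesc Q hQ hd => ⟨hQ, ?_⟩⟩
  by_contra hdiv
  obtain ⟨e, G, hseq, hthread⟩ :=
    hd.exists_approxInfiniteCallSeq hQ fun hacc => hdiv (exists_eval_of_acc hacc)
  exact hthread (hdesc e G hseq)

theorem mainTheorem4 {V : Type*} [DecidableEq V] {N : Type*} [Finite N]
    (Γ : LambdaSCT.Grammar V N) (P : LambdaSCT.ExtExp V N) (hP : LambdaSCT.ExtClosed Γ P) :
    ((∃ (Q : LambdaSCT.PureExp V) (hQ : Q.Closed), LambdaSCT.Derives Γ P Q ∧
        ∃ s : ℕ → LambdaSCT.State V, LambdaSCT.IsInfiniteCallSeq Q hQ s) →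
      ∃ (e : ℕ → LambdaSCT.ExtExp V N) (G : ℕ → LambdaSCT.Graph V),
        LambdaSCT.IsApproxInfiniteCallSeq Γ P e G ∧
          ¬ LambdaSCT.HasInfinitelyDescendingThread G) ∧
    ((∀ (e : ℕ → LambdaSCT.ExtExp V N) (G : ℕ → LambdaSCT.Graph V),
        LambdaSCT.IsApproxInfiniteCallSeq Γ P e G → LambdaSCT.HasInfinitelyDescendingThread G) →
      LambdaSCT.GammaTerminating Γ P) :=
  have ⟨hinf, hterm⟩ := mainTheorem4_general Γ P
  ⟨hinf, fun hdesc τ hτ => hterm hdesc _ (hP _ (.subst P τ hτ)) (.subst P τ hτ)⟩
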